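/- \textbf{Conventions.} An \emph{equational signature} consists of countable sets $C,F,P$ of constant, function and predicate symbols, the last two with arities in $\mathbb N$; its morphisms are arity-preserving maps of symbols; $\mathrm{Term}(\Theta)$ is the set of ground terms over $\Theta$, and the equational sentences over $\Theta$ are the ground equations $t=t'$ and the ground predications $p(t_1,\dots,t_n)$. For equational signatures $\Theta,\Theta'$, $\mathbf{Defs}(\Theta,\Theta')$ is the set of sentences over $\Theta+\Theta'$ of the forms $c=t$, $f(t_1,\dots,t_n)=t$, $p(t_1,\dots,t_n)$ with $c,f,p$ symbols of $\Theta$ and $t,t_1,\dots,t_n\in\mathrm{Term}(\Theta')$. Let $\mathsf L$ be a logic (a category of signatures, a functor of sentences, a functor of models, an entailment system and an institution over them, with entailment sound for satisfaction) with a state sublanguage, i.e. a subfunctor of its sentence functor, functors $\mathbf{RSign},\mathbf{FSign}$ (rigid and flexible symbols) from $\mathsf{Sign}^{\mathsf L}$ to equational signatures, and a natural transformation from the subfunctor to the equational sentences over $\mathbf{RSign}+\mathbf{FSign}$. For a signature $\Sigma$ of $\mathsf L$, the set of \emph{states} $|\mathbf{States}^{\mathsf L}(\Sigma)|$ is the set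 of all theory presentations $\langle \mathbf{FSign}(\Sigma)+\mathbf{RSign}(\Sigma),\Gamma\rangle$ with $\Gamma\subseteq\mathbf{Defs}(\mathbf{FSign}(\Sigma),\mathbf{RSign}(\Sigma))$. The \emph{elementary theory of relations with closure} $\mathsf{ETR}^*$ has as signatures countable families $\{R_i\}_{i\in I}$ of binary relation symbols. Relational terms are built from the $R_i$ and $0,1,1'$ by $+,\cdot,\overline{\phantom{R}},;,\breve{\phantom{R}},{}^*$. Formulae are built from the atoms $x\,R\,y$ and $R=S$ ($R,S$ relational terms, $x,y$ from a countable set of individual variables) by $\neg$, $\bigvee$ of countable sets of formulae, and $\exists x$; sentences are the formulae without free variables. A theory presentation is a signature with a set of sentences. A \emph{proper closure relation algebra} on a base set $U$ is a set $A$ of binary relations on $U$ that contains $\emptyset$, the identity, and a relation $E$ with $\bigcup A\subseteq E$, and is closed under union, intersection, complement relative to $E$, composition, converse, and reflexive-transitive closure. A \emph{model} of a signature consists of such an algebra and an element $R_i^A\in A$ for each $R_i$. Relational terms are interpreted in the evident way ($1$ as $E$), and sentences are evaluated as usual with variables ranging over $U$. \textbf{Lemma.} Let $\mathbf{RelTh}$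 be a functor assigning to each signature of $\mathsf L$ a theory presentation of $\mathsf{ETR}^*$ (only its action on objects matters, and any assignment is allowed), let $\Sigma$ be a signature of $\mathsf L$, and let $\mathcal M$, with base set $U$, be a model of $\mathbf{RelTh}(\Sigma)$ over a proper closure relation algebra. If $|\mathbf{States}^{\mathsf L}(\Sigma)|$ is finite, assume that $U$ has at most as many elements as $|\mathbf{States}^{\mathsf L}(\Sigma)|$; if it is infinite, assume nothing more. Then there is a \emph{state proper closure relation algebra} for $\mathbf{RelTh}(\Sigma)$, i.e. a model $\mathcal M'$ of $\mathbf{RelTh}(\Sigma)$ over a proper closure relation algebra whose base set is a subset of $|\mathbf{States}^{\mathsf L}(\Sigma)|$, such that for every $\mathsf{ETR}^*$ sentence $\alpha$ over the signature of $\mathbf{RelTh}(\Sigma)$, $\mathcal M\models\alpha$ implies $\mathcal M'\models\alpha$. -/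

import Mathlib

open CategoryTheory
open scoped SetRel

/-! ### Equational logic with predicate symbols -/

/-- A signature of equational logic: countable families of constant, function and predicate
symbols, the last two with arities. -/
structure EqSig : Type 1 where
  C : Type
  F : Type
  P : Type
  countable_C : Countable C
  countable_F : Countable F
  countable_P : Countable P
  arF : F → ℕ
  arP : P → ℕ

namespace EqSig

/-- Morphisms of equational signatures: arity preserving maps of symbols. -/
@[ext]
structure Hom (S T : EqSig) where
  onC : S.C → T.C
  onF : S.F → T.F
  onP : S.P → T.P
  arF_onF : ∀ f, T.arF (onF f) = S.arF f
  arP_onP : ∀ p, T.arP (onP p) = S.arP p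

instance : Category EqSig where
  Hom := Hom
  id S := ⟨id, id, id, fun _ => rfl, fun _ => rfl⟩
  comp σ τ :=
    ⟨τ.onC ∘ σ.onC, τ.onF ∘ σ.onF, τ.onP ∘ σ.onP,
      fun f => (τ.arF_onF (σ.onF f)).trans (σ.arF_onF f),
      fun p => (τ.arP_onP (σ.onP p)).trans (σ.arP_onP p)⟩

/-- The sum (disjoint union) of two signatures. -/
def sum (S T : EqSig) : EqSig where
  C := S.C ⊕ T.C
  F := S.F ⊕ T.F
  P := S.P ⊕ T.P
  countable_C := by
    have := S.countable_C; have := T.countable_C; infer_instance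
  countable_F := by
    have := S.countable_F; have := T.countable_F; infer_instance
  countable_P := by
    have := S.countable_P; have := T.countable_P; infer_instance
  arF := Sum.elim S.arF T.arF
  arP := Sum.elim S.arP T.arP

/-- The sum of two signature morphisms. -/
def sumMap {S S' T T' : EqSig} (σ : Hom S S') (τ : Hom T T') :
    Hom (S.sum T) (S'.sum T') where
  onC := Sum.map σ.onC τ.onC
  onF := Sum.map σ.onF τ.onF
  onP := Sum.map σ.onP τ.onP
  arF_onF := by
    rintro (f | f)
    · exact σ.arF_onF f
    · exact τ.arF_onF f
  arP_onP := by
    rintro (p | p)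
    · exact σ.arP_onP p
    · exact τ.arP_onP p

/-- The right injection into a sum of signatures. -/
def inr (S T : EqSig) : Hom T (S.sum T) where
  onC := Sum.inr
  onF := Sum.inr
  onP := Sum.inr
  arF_onF _ := rfl
  arP_onP _ := rfl

/-- The pointwise sum of two functors into the category of equational signatures. -/
def sumFunctor {D : Type*} [Category D] (R F : D ⥤ EqSig) : D ⥤ EqSig where
  obj d := (R.obj d).sum (F.obj d)
  map f := sumMap (R.map f) (F.map f)
  map_id d := by
    rw [R.map_id, F.map_id]
    apply Hom.ext
    all_goals
      funext x
      rcases x with x | x <;> rfl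
  map_comp f g := by
    rw [R.map_comp, F.map_comp]
    apply Hom.ext
    all_goals
      funext x
      rcases x with x | x <;> rfl

end EqSig

/-- Ground terms over an equational signature. -/
inductive EqTerm (S : EqSig) : Type
  | const (c : S.C) : EqTerm S
  | app (f : S.F) (ts : Fin (S.arF f) → EqTerm S) : EqTerm S

/-- Sentences of equational logic: ground equations and ground predications. -/
inductive EqSen (S : EqSig) : Type
  | eq (t t' : EqTerm S) : EqSen S
  | pred (p : S.P) (ts : Fin (S.arP p) → EqTerm S) : EqSen S

/-- The translation of terms along a signature morphism. -/
def EqTerm.map {S T : EqSig} (σ : EqSig.Hom S T) : EqTerm S → EqTerm T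
  | .const c => .const (σ.onC c)
  | .app f ts => .app (σ.onF f) fun i => (ts (Fin.cast (σ.arF_onF f) i)).map σ

/-- The translation of sentences along a signature morphism. -/
def EqSen.map {S T : EqSig} (σ : EqSig.Hom S T) : EqSen S → EqSen T
  | .eq t t' => .eq (t.map σ) (t'.map σ)
  | .pred p ts => .pred (σ.onP p) fun i => (ts (Fin.cast (σ.arP_onP p) i)).map σ

theorem EqTerm.map_id {S : EqSig} (t : EqTerm S) : t.map (𝟙 S : S ⟶ S) = t := by
  induction t with
  | const c => rfl
  | app f ts ih => exact congrArg (EqTerm.app f) (funext fun i => ih i)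

theorem EqTerm.map_comp {S T W : EqSig} (σ : S ⟶ T) (τ : T ⟶ W) (t : EqTerm S) :
    t.map (σ ≫ τ) = (t.map σ).map τ := by
  induction t with
  | const c => rfl
  | app f ts ih => exact congrArg (EqTerm.app (τ.onF (σ.onF f))) (funext fun i => ih _)

/-- The sentence functor of equational logic. -/
def EqSen.functor : EqSig ⥤ Type where
  obj S := EqSen S
  map σ := TypeCat.ofHom (EqSen.map σ)
  map_id S := by
    ext s
    cases s with
    | eq t t' => exact congrArg₂ EqSen.eq t.map_id t'.map_id
    | pred p ts => exact congrArg (EqSen.pred p) (funext fun i => (ts i).map_id)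
  map_comp σ τ := by
    ext s
    cases s with
    | eq t t' => exact congrArg₂ EqSen.eq (t.map_comp σ τ) (t'.map_comp σ τ)
    | pred p ts =>
      exact congrArg (EqSen.pred (τ.onP (σ.onP p)))
        (funext fun i => (ts (Fin.cast _ i)).map_comp σ τ)

/-- The definitions of the symbols of `S` by ground terms over `T`, as sentences over the sum of
the two signatures: `c = t`, `f(t₁,…,tₙ) = t` and `p(t₁,…,tₙ)`, with `c`, `f`, `p` symbols of `S`
and `t₁,…,tₙ`, `t` ground terms over `T`. -/
def EqSig.Defs (S T : EqSig) : Set (EqSen (S.sum T)) :=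
  {s | (∃ (c : S.C) (t : EqTerm T),
          s = .eq (.const (Sum.inl c)) (t.map (EqSig.inr S T))) ∨
       (∃ (f : S.F) (ts : Fin (S.arF f) → EqTerm T) (t : EqTerm T),
          s = .eq (.app (Sum.inl f : (S.sum T).F) fun i => (ts i).map (EqSig.inr S T))
                (t.map (EqSig.inr S T))) ∨
       (∃ (p : S.P) (ts : Fin (S.arP p) → EqTerm T),
          s = .pred (Sum.inl p : (S.sum T).P) fun i => (ts i).map (EqSig.inr S T))}

/-- The states assigning terms over `T` to the symbols of `S`: the equational theory presentations
over the sum signature whose axioms are definitions of symbols of `S` by terms over `T`. -/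
def EqSig.Sts (S T : EqSig) : Type :=
  {Γ : Set (EqSen (S.sum T)) // Γ ⊆ EqSig.Defs S T}

/-! ### Logics and their state sublanguages -/

/-- A logic: signatures, sentences, models, an entailment relation forming an entailment system
and a satisfaction relation forming an institution, with entailment sound for satisfaction. -/
structure Logic.{u, v, w, u', v'} where
  Sign : Type u
  [category : Category.{v} Sign]
  Sen : Sign ⥤ Type w
  Mod : Signᵒᵖ ⥤ Cat.{v', u'}
  Entails : ∀ s : Sign, Set (Sen.obj s) → Sen.obj s → Prop
  Models : ∀ s : Sign, Mod.obj (Opposite.op s) → Sen.obj s → Prop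
  entails_refl : ∀ (s : Sign) (φ : Sen.obj s), Entails s {φ} φ
  entails_mono : ∀ (s : Sign) (Γ Γ' : Set (Sen.obj s)) (φ : Sen.obj s),
    Entails s Γ φ → Γ ⊆ Γ' → Entails s Γ' φ
  entails_trans : ∀ (s : Sign) (Γ Δ : Set (Sen.obj s)) (φ : Sen.obj s),
    (∀ δ ∈ Δ, Entails s Γ δ) → Entails s Δ φ → Entails s Γ φ
  entails_map : ∀ {s t : Sign} (σ : s ⟶ t) (Γ : Set (Sen.obj s)) (φ : Sen.obj s),
    Entails s Γ φ → Entails t (Sen.map σ '' Γ) (Sen.map σ φ)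
  models_map : ∀ {s t : Sign} (σ : s ⟶ t) (M : Mod.obj (Opposite.op t)) (φ : Sen.obj s),
    Models t M (Sen.map σ φ) ↔ Models s ((Mod.map σ.op).toFunctor.obj M) φ
  sound : ∀ (s : Sign) (Γ : Set (Sen.obj s)) (φ : Sen.obj s), Entails s Γ φ →
    ∀ M : Mod.obj (Opposite.op s), (∀ γ ∈ Γ, Models s M γ) → Models s M φ

attribute [instance] Logic.category

/-- A state sublanguage of a logic: a subfunctor of state sentences, functors giving the rigid and
the flexible symbols of a signature, and a natural translation of the state sentences into
equational logic over the rigid and flexible symbols. -/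
structure StateSublanguage.{u, v, w, u', v'} (L : Logic.{u, v, w, u', v'}) where
  StSen : Subfunctor L.Sen
  RSign : L.Sign ⥤ EqSig
  FSign : L.Sign ⥤ EqSig
  ρ : StSen.toFunctor ⟶ EqSig.sumFunctor RSign FSign ⋙ EqSen.functor ⋙ uliftFunctor.{w, 0}

/-- The states over a signature of the logic: definitions of the flexible symbols by ground terms
over the rigid symbols. -/
def StateSublanguage.States {L : Logic} (K : StateSublanguage L) (s : L.Sign) : Type :=
  EqSig.Sts (K.FSign.obj s) (K.RSign.obj s)

/-! ### The elementary theory of relations with closure -/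

/-- A signature: a countable family of binary relation symbols. -/
structure RelSig : Type 1 where
  I : Type
  countable_I : Countable I

/-- Relational terms. -/
inductive RelTerm (S : RelSig) : Type
  | rel (i : S.I) : RelTerm S
  | zero : RelTerm S
  | one : RelTerm S
  | ident : RelTerm S
  | add (R T : RelTerm S) : RelTerm S
  | mul (R T : RelTerm S) : RelTerm S
  | compl (R : RelTerm S) : RelTerm S
  | comp (R T : RelTerm S) : RelTerm S
  | conv (R : RelTerm S) : RelTerm S
  | star (R : RelTerm S) : RelTerm S

/-- Formulae over the individual variables `X`, with disjunctions of countable sets of formulae;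
such a set is given as a family indexed by a set of natural numbers. -/
inductive RelForm (S : RelSig) (X : Type) : Type
  | atom (x : X) (R : RelTerm S) (y : X) : RelForm S X
  | eq (R T : RelTerm S) : RelForm S X
  | neg (α : RelForm S X) : RelForm S X
  | disj (J : Set ℕ) (α : J → RelForm S X) : RelForm S X
  | ex (x : X) (α : RelForm S X) : RelForm S X

/-- The free variables of a formula. -/
def RelForm.freeVars {S : RelSig} {X : Type} : RelForm S X → Set X
  | .atom x _ y => {x, y}
  | .eq _ _ => ∅
  | .neg α => α.freeVars
  | .disj _ α => ⋃ j, (α j).freeVars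
  | .ex x α => α.freeVars \ {x}

/-- Sentences: formulae without free variables. -/
def RelSen (S : RelSig) (X : Type) : Type :=
  {α : RelForm S X // α.freeVars = ∅}

/-- Theory presentations. -/
structure RelTheory (X : Type) : Type 1 where
  sig : RelSig
  ax : Set (RelSen sig X)

/-- Powers of a binary relation. -/
def relPow {U : Type*} (r : SetRel U U) : ℕ → SetRel U U
  | 0 => SetRel.id
  | n + 1 => r ○ relPow r n

/-- Reflexive and transitive closure, as the union of all powers. -/
def relStar {U : Type*} (r : SetRel U U) : SetRel U U :=
  ⋃ n, relPow r n

/-- A proper closure relation algebra on the base set `U`: its carrier `A`, whose largest element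
`E` need not be the full relation, is closed under the set-theoretic operations on relations. -/
structure PCRA (U : Type*) where
  A : Set (SetRel U U)
  E : SetRel U U
  empty_mem : ∅ ∈ A
  unit_mem : E ∈ A
  sUnion_subset : ⋃₀ A ⊆ E
  id_mem : SetRel.id ∈ A
  union_mem : ∀ r ∈ A, ∀ t ∈ A, r ∪ t ∈ A
  inter_mem : ∀ r ∈ A, ∀ t ∈ A, r ∩ t ∈ A
  compl_mem : ∀ r ∈ A, E \ r ∈ A
  comp_mem : ∀ r ∈ A, ∀ t ∈ A, r ○ t ∈ A
  conv_mem : ∀ r ∈ A, r.inv ∈ A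
  star_mem : ∀ r ∈ A, relStar r ∈ A

/-- A model of a signature over a proper closure relation algebra on the base set `U`. -/
structure RelModel (S : RelSig) (U : Type*) where
  alg : PCRA U
  interp : S.I → SetRel U U
  interp_mem : ∀ i, interp i ∈ alg.A

namespace RelModel

/-- The relation denoted by a relational term. -/
def eval {S : RelSig} {U : Type*} (M : RelModel S U) : RelTerm S → SetRel U U
  | .rel i => M.interp i
  | .zero => ∅
  | .one => M.alg.E
  | .ident => SetRel.id
  | .add R T => M.eval R ∪ M.eval T
  | .mul R T => M.eval R ∩ M.eval T
  | .compl R => M.alg.E \ M.eval R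
  | .comp R T => M.eval R ○ M.eval T
  | .conv R => (M.eval R).inv
  | .star R => relStar (M.eval R)

open Classical in
/-- Satisfaction of a formula under a partial valuation of the variables; an atomic formula with a
variable that has no value is not satisfied. -/
def Sat {S : RelSig} {X : Type} {U : Type*} (M : RelModel S U) :
    (X → Option U) → RelForm S X → Prop
  | v, .atom x R y => ∃ a b, v x = some a ∧ v y = some b ∧ (a, b) ∈ M.eval R
  | _, .eq R T => ∀ a b, (a, b) ∈ M.eval R ↔ (a, b) ∈ M.eval T
  | v, .neg α => ¬ M.Sat v α
  | v, .disj _ α => ∃ j, M.Sat v (α j)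
  | v, .ex x α => ∃ a : U, M.Sat (Function.update v x (some a)) α

/-- Satisfaction of a sentence: satisfaction under the empty valuation. -/
def Models {S : RelSig} {X : Type} {U : Type*} (M : RelModel S U) (α : RelSen S X) : Prop :=
  M.Sat (fun _ => none) α.1

/-- `M` is a model of the theory presentation `T`. -/
def IsModelOf {X : Type} {T : RelTheory X} {U : Type*} (M : RelModel T.sig U) : Prop :=
  ∀ γ ∈ T.ax, M.Models γ

end RelModel

/-- A state proper closure relation algebra for a theory presentation `T`: a model of `T` over a
proper closure relation algebra whose base set is a subset of the given set `St` of states. -/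
structure StatePCRA (St : Type) {X : Type} (T : RelTheory X) where
  base : Set St
  model : RelModel T.sig base
  isModel : model.IsModelOf

/-!
The lemma is a downward Löwenheim–Skolem theorem for the infinitary language of `ETR*`, combined
with a dichotomy for the number of states. A set of states is a powerset of a set of definitions,
so it is either finite or at least of the cardinality `𝔠` of the continuum
(`EqSig.continuum_le_mk_sts`). If it is finite, the base set embeds into it by hypothesis and the
model is transported along the embedding.

If it is infinite, it suffices to shrink the model to cardinality at most `𝔠` while keeping *all*
sentences, although uncountably many disjunctions are available. A countable signature has only `𝔠`
formulae (`RelForm.mk_le_continuum`), and along the evaluation of a sentence only finitely many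
variables ever receive a value. Hence a subset of cardinality at most `𝔠` can be closed under
Skolem functions (`RelModel.exists_isWitnessClosed_mk_le_continuum`), not only for existential
formulae but also for compositions of relations and for inequalities of relational terms.
Restricting to such a subset the relations denoted by terms commutes with composition, hence with
finite powers and closure, so the restrictions form again a proper closure relation algebra
(`RelModel.IsWitnessClosed.pullback`), and the Tarski–Vaught test
(`RelModel.IsWitnessClosed.sat_pullback_iff`) shows that the same sentences hold.
-/

/-! ### Finite valuations and witness-closed maps -/

open Classical in
/-- The valuation with finite support given by a list of bindings, earlier bindings overriding
later ones. -/
noncomputable def listValuation {X : Type} {U : Type*} (l : List (X × U)) : X → Option U :=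
  l.foldr (fun p v => Function.update v p.1 (some p.2)) fun _ => none

theorem listValuation_map {X : Type} {U V : Type*} (f : V → U) (l : List (X × V)) (x : X) :
    listValuation (l.map (Prod.map id f)) x = (listValuation l x).map f := by
  classical
  induction l with
  | nil => rfl
  | cons p l ih =>
    by_cases h : x = p.1
    · subst h
      simp [listValuation]
    · simpa [listValuation, Function.update_of_ne h] using ih

namespace RelModel

variable {S : RelSig} {X : Type} {U V : Type*}

theorem eval_mem (M : RelModel S U) (R : RelTerm S) : M.eval R ∈ M.alg.A := by
  induction R with
  | rel i => exact M.interp_mem i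
  | zero => exact M.alg.empty_mem
  | one => exact M.alg.unit_mem
  | ident => exact M.alg.id_mem
  | add R T hR hT => exact M.alg.union_mem _ hR _ hT
  | mul R T hR hT => exact M.alg.inter_mem _ hR _ hT
  | compl R hR => exact M.alg.compl_mem _ hR
  | comp R T hR hT => exact M.alg.comp_mem _ hR _ hT
  | conv R hR => exact M.alg.conv_mem _ hR
  | star R hR => exact M.alg.star_mem _ hR

/-- The Tarski–Vaught condition for a map `f` into the base set of `M`: the image of `f` contains
the intermediate points required by compositions, a pair telling apart any two terms with distinct
values, and witnesses for existential formulae with parameters in the image. Intermediate points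
and separating pairs are required separately because `X` may have too few variables for formulae
to express them. -/
structure IsWitnessClosed (M : RelModel S U) (X : Type) (f : V → U) : Prop where
  comp : ∀ R T a b, (f a, f b) ∈ M.eval R ○ M.eval T →
    ∃ c, (f a, f c) ∈ M.eval R ∧ (f c, f b) ∈ M.eval T
  separates : ∀ R T, M.eval R ≠ M.eval T →
    ∃ a b, ¬((f a, f b) ∈ M.eval R ↔ (f a, f b) ∈ M.eval T)
  ex : ∀ (α : RelForm S X) (x : X) (l : List (X × V)),
    (∃ u, M.Sat (listValuation ((x, u) :: l.map (Prod.map id f))) α) →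
      ∃ a, M.Sat (listValuation ((x, f a) :: l.map (Prod.map id f))) α

theorem isWitnessClosed_id (M : RelModel S U) (X : Type) : M.IsWitnessClosed X (id : U → U) where
  comp _ _ _ _ h := h
  separates R T hne := by
    by_contra! h
    exact hne (Set.ext fun ⟨a, b⟩ => h a b)
  ex _ _ _ h := h

theorem IsWitnessClosed.comp_equiv {V' : Type*} {M : RelModel S U} {f : V → U}
    (h : M.IsWitnessClosed X f) (e : V' ≃ V) : M.IsWitnessClosed X (f ∘ e) where
  comp R T a b hab := by
    obtain ⟨c, hc⟩ := h.comp R T (e a) (e b) hab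
    exact ⟨e.symm c, by simpa using hc⟩
  separates R T hne := by
    obtain ⟨a, b, hab⟩ := h.separates R T hne
    exact ⟨e.symm a, e.symm b, by simpa using hab⟩
  ex α x l hu := by
    have hl : l.map (Prod.map id (f ∘ e)) = (l.map (Prod.map id e)).map (Prod.map id f) := by
      simp
    rw [hl] at hu ⊢
    obtain ⟨a, ha⟩ := h.ex α x _ hu
    exact ⟨e.symm a, by simpa using ha⟩

/-! ### The pulled back model -/

/-- The inverse image of a relation along a map. -/
def pullRel (f : V → U) (r : SetRel U U) : SetRel V V :=
  Prod.map f f ⁻¹' r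

@[simp]
theorem mem_pullRel {f : V → U} {r : SetRel U U} {a b : V} :
    (a, b) ∈ pullRel f r ↔ (f a, f b) ∈ r :=
  Iff.rfl

theorem pullRel_id {f : V → U} (hf : Function.Injective f) :
    pullRel f SetRel.id = SetRel.id := by
  ext ⟨a, b⟩
  exact hf.eq_iff

/-- The `n`-fold composition of a relational term with itself. -/
def termPow (R : RelTerm S) : ℕ → RelTerm S
  | 0 => .ident
  | n + 1 => .comp R (termPow R n)

theorem eval_termPow (M : RelModel S U) (R : RelTerm S) (n : ℕ) :
    M.eval (termPow R n) = relPow (M.eval R) n := by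
  induction n with
  | zero => rfl
  | succ n ih => exact congrArg (M.eval R ○ ·) ih

namespace IsWitnessClosed

variable {M : RelModel S U} {f : V → U}

theorem pullRel_comp (h : M.IsWitnessClosed X f) (R T : RelTerm S) :
    pullRel f (M.eval R ○ M.eval T) = pullRel f (M.eval R) ○ pullRel f (M.eval T) := by
  ext ⟨a, b⟩
  exact ⟨fun hab => h.comp R T a b hab, fun ⟨c, hc⟩ => ⟨f c, hc⟩⟩

/-- Closure under intermediate points of compositions suffices for closures, since all finite
powers of a term are themselves denoted by terms. -/
theorem pullRel_star (h : M.IsWitnessClosed X f) (hf : Function.Injective f) (R : RelTerm S) :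
    pullRel f (relStar (M.eval R)) = relStar (pullRel f (M.eval R)) := by
  have key : ∀ n, pullRel f (relPow (M.eval R) n) = relPow (pullRel f (M.eval R)) n := by
    intro n
    induction n with
    | zero => exact pullRel_id hf
    | succ n ih =>
      have := h.pullRel_comp R (termPow R n)
      rw [eval_termPow, ih] at this
      exact this
  simp only [relStar, ← key]
  exact Set.preimage_iUnion

/-- The model on the domain of an injective witness-closed map whose relations are the inverse
images of those denoted by relational terms. -/
def pullback (h : M.IsWitnessClosed X f) (hf : Function.Injective f) : RelModel S V where
  alg :=
    { A := Set.range fun R => pullRel f (M.eval R)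
      E := pullRel f M.alg.E
      empty_mem := ⟨.zero, rfl⟩
      unit_mem := ⟨.one, rfl⟩
      sUnion_subset := by
        rintro p ⟨_, ⟨R, rfl⟩, hp⟩
        exact M.alg.sUnion_subset ⟨_, M.eval_mem R, hp⟩
      id_mem := ⟨.ident, pullRel_id hf⟩
      union_mem := by
        rintro _ ⟨R, rfl⟩ _ ⟨T, rfl⟩
        exact ⟨.add R T, rfl⟩
      inter_mem := by
        rintro _ ⟨R, rfl⟩ _ ⟨T, rfl⟩
        exact ⟨.mul R T, rfl⟩
      compl_mem := by
        rintro _ ⟨R, rfl⟩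
        exact ⟨.compl R, rfl⟩
      comp_mem := by
        rintro _ ⟨R, rfl⟩ _ ⟨T, rfl⟩
        exact ⟨.comp R T, h.pullRel_comp R T⟩
      conv_mem := by
        rintro _ ⟨R, rfl⟩
        exact ⟨.conv R, rfl⟩
      star_mem := by
        rintro _ ⟨R, rfl⟩
        exact ⟨.star R, h.pullRel_star hf R⟩ }
  interp i := pullRel f (M.interp i)
  interp_mem i := ⟨.rel i, rfl⟩

theorem eval_pullback (h : M.IsWitnessClosed X f) (hf : Function.Injective f) (R : RelTerm S) :
    (h.pullback hf).eval R = pullRel f (M.eval R) := by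
  induction R with
  | rel i => rfl
  | zero => rfl
  | one => rfl
  | ident => exact (pullRel_id hf).symm
  | add R T hR hT => simp only [eval, hR, hT]; rfl
  | mul R T hR hT => simp only [eval, hR, hT]; rfl
  | compl R hR => simp only [eval, hR]; rfl
  | comp R T hR hT => simp only [eval, hR, hT, h.pullRel_comp]
  | conv R hR => simp only [eval, hR]; rfl
  | star R hR => simp only [eval, hR, h.pullRel_star hf]

/-- The Tarski–Vaught test: `f` is an elementary embedding for the infinitary language. Finite
valuations suffice, as the evaluation of a sentence starts from the empty valuation and each
quantifier adds one binding. -/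
theorem sat_pullback_iff (h : M.IsWitnessClosed X f) (hf : Function.Injective f)
    (α : RelForm S X) (l : List (X × V)) :
    (h.pullback hf).Sat (listValuation l) α ↔
      M.Sat (listValuation (l.map (Prod.map id f))) α := by
  induction α generalizing l with
  | atom x R y =>
    simp only [Sat, eval_pullback, listValuation_map, Option.map_eq_some_iff, mem_pullRel]
    constructor
    · rintro ⟨a, b, ha, hb, hab⟩
      exact ⟨_, _, ⟨a, ha, rfl⟩, ⟨b, hb, rfl⟩, hab⟩
    · rintro ⟨_, _, ⟨a, ha, rfl⟩, ⟨b, hb, rfl⟩, hab⟩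
      exact ⟨a, b, ha, hb, hab⟩
  | eq R T =>
    simp only [Sat, eval_pullback, mem_pullRel]
    refine ⟨fun hRT => ?_, fun hRT a b => hRT _ _⟩
    by_contra hne
    obtain ⟨a, b, hab⟩ := h.separates R T fun he => hne fun a b => by rw [he]
    exact hab (hRT a b)
  | neg α ih => exact not_congr (ih l)
  | disj J α ih => exact exists_congr fun j => ih j l
  | ex x α ih =>
    -- Updating a list valuation is, by definition, prepending a binding.
    refine (exists_congr fun a => ih ((x, a) :: l)).trans ?_
    exact ⟨fun ⟨a, ha⟩ => ⟨f a, ha⟩, fun hu => h.ex α x l hu⟩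

theorem models_pullback_iff (h : M.IsWitnessClosed X f) (hf : Function.Injective f)
    (α : RelSen S X) : (h.pullback hf).Models α ↔ M.Models α :=
  h.sat_pullback_iff hf α.1 []

end IsWitnessClosed

end RelModel

/-! ### Cardinalities of terms, formulae and states -/

section Cardinality

open Cardinal

instance RelTerm.countable (S : RelSig) : Countable (RelTerm S) := by
  have := S.countable_I
  -- The labels are the leaves, three unary operations and three binary operations.
  let β : (S.I ⊕ Fin 3) ⊕ Fin 3 ⊕ Fin 3 → Type :=
    Sum.elim (fun _ => Empty) (Sum.elim (fun _ => Unit) fun _ => Bool)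
  have hβ : ∀ a, Finite (β a) := by
    rintro (a | a | a)
    · exact inferInstanceAs (Finite Empty)
    · exact inferInstanceAs (Finite Unit)
    · exact inferInstanceAs (Finite Bool)
  let step : (Σ a, β a → RelTerm S) → RelTerm S
    | ⟨.inl (.inl i), _⟩ => .rel i
    | ⟨.inl (.inr k), _⟩ => ![.zero, .one, .ident] k
    | ⟨.inr (.inl k), c⟩ => ![.compl (c ()), .conv (c ()), .star (c ())] k
    | ⟨.inr (.inr k), c⟩ =>
      ![.add (c true) (c false), .mul (c true) (c false), .comp (c true) (c false)] k
  have hW : Countable (WType β) := by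
    rw [← mk_le_aleph0_iff]
    refine WType.cardinalMk_le_max_aleph0_of_finite.trans (max_le ?_ le_rfl)
    exact mk_le_aleph0
  have hsurj : Function.Surjective (WType.elim _ step) := by
    intro R
    induction R with
    | rel i => exact ⟨.mk (.inl (.inl i)) Empty.elim, rfl⟩
    | zero => exact ⟨.mk (.inl (.inr 0)) Empty.elim, rfl⟩
    | one => exact ⟨.mk (.inl (.inr 1)) Empty.elim, rfl⟩
    | ident => exact ⟨.mk (.inl (.inr 2)) Empty.elim, rfl⟩
    | compl R hR =>
      obtain ⟨a, rfl⟩ := hR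
      exact ⟨.mk (.inr (.inl 0)) fun _ => a, rfl⟩
    | conv R hR =>
      obtain ⟨a, rfl⟩ := hR
      exact ⟨.mk (.inr (.inl 1)) fun _ => a, rfl⟩
    | star R hR =>
      obtain ⟨a, rfl⟩ := hR
      exact ⟨.mk (.inr (.inl 2)) fun _ => a, rfl⟩
    | add R T hR hT =>
      obtain ⟨a, rfl⟩ := hR
      obtain ⟨b, rfl⟩ := hT
      exact ⟨.mk (.inr (.inr 0)) fun i : Bool => cond i a b, rfl⟩
    | mul R T hR hT =>
      obtain ⟨a, rfl⟩ := hR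
      obtain ⟨b, rfl⟩ := hT
      exact ⟨.mk (.inr (.inr 1)) fun i : Bool => cond i a b, rfl⟩
    | comp R T hR hT =>
      obtain ⟨a, rfl⟩ := hR
      obtain ⟨b, rfl⟩ := hT
      exact ⟨.mk (.inr (.inr 2)) fun i : Bool => cond i a b, rfl⟩
  exact hsurj.countable

theorem mk_wType_le_continuum {α : Type} {β : α → Type} [∀ a, Countable (β a)]
    (hα : #α ≤ 𝔠) : #(WType β) ≤ 𝔠 := by
  refine WType.cardinalMk_le_of_le ?_
  calc sum (fun a => 𝔠 ^ #(β a))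
      ≤ sum fun _ : α => 𝔠 := sum_le_sum _ _ fun a =>
        (power_le_power_left continuum_ne_zero mk_le_aleph0).trans_eq continuum_power_aleph0
    _ = #α * 𝔠 := sum_const' _ _
    _ ≤ 𝔠 * 𝔠 := by gcongr
    _ = 𝔠 := continuum_mul_self

theorem RelForm.mk_le_continuum (S : RelSig) (X : Type) [Countable X] :
    #(RelForm S X) ≤ 𝔠 := by
  -- The labels are the atoms, `none` for negation, `some x` for quantification over `x`, and the
  -- index sets of disjunctions.
  let β : ((X × RelTerm S × X) ⊕ (RelTerm S × RelTerm S)) ⊕ Option X ⊕ Set ℕ → Type :=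
    Sum.elim (fun _ => Empty) (Sum.elim (fun _ => Unit) fun J => J)
  have hβ : ∀ a, Countable (β a) := by
    rintro (a | a | J)
    · exact inferInstanceAs (Countable Empty)
    · exact inferInstanceAs (Countable Unit)
    · exact inferInstanceAs (Countable J)
  let step : (Σ a, β a → RelForm S X) → RelForm S X
    | ⟨.inl (.inl (x, R, y)), _⟩ => .atom x R y
    | ⟨.inl (.inr (R, T)), _⟩ => .eq R T
    | ⟨.inr (.inl none), c⟩ => .neg (c ())
    | ⟨.inr (.inl (some x)), c⟩ => .ex x (c ())
    | ⟨.inr (.inr J), c⟩ => .disj J c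
  have hsurj : Function.Surjective (WType.elim _ step) := by
    intro α
    induction α with
    | atom x R y => exact ⟨.mk (.inl (.inl (x, R, y))) Empty.elim, rfl⟩
    | eq R T => exact ⟨.mk (.inl (.inr (R, T))) Empty.elim, rfl⟩
    | neg α ih =>
      obtain ⟨a, rfl⟩ := ih
      exact ⟨.mk (.inr (.inl none)) fun _ => a, rfl⟩
    | disj J α ih =>
      choose a ha using ih
      obtain rfl : (fun j => WType.elim _ step (a j)) = α := funext ha
      exact ⟨.mk (.inr (.inr J)) a, rfl⟩
    | ex x α ih =>
      obtain ⟨a, rfl⟩ := ih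
      exact ⟨.mk (.inr (.inl (some x))) fun _ => a, rfl⟩
  refine (mk_le_of_surjective hsurj).trans (mk_wType_le_continuum ?_)
  rw [mk_sum, mk_sum (Option X), lift_id, lift_id, lift_id, lift_id, mk_set, mk_nat,
    two_power_aleph0]
  refine add_le_of_le aleph0_le_continuum (mk_le_aleph0.trans aleph0_le_continuum)
    (add_le_of_le aleph0_le_continuum (mk_le_aleph0.trans aleph0_le_continuum) le_rfl)

/-- An infinite set of states has at least the cardinality of the continuum, being the powerset of
an infinite set of definitions. -/
theorem EqSig.continuum_le_mk_sts (S T : EqSig) [Infinite (EqSig.Sts S T)] :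
    𝔠 ≤ #(EqSig.Sts S T) := by
  have h : #(EqSig.Sts S T) = 2 ^ #(EqSig.Defs S T) := mk_powerset (EqSig.Defs S T)
  have hinf : ℵ₀ ≤ #(EqSig.Defs S T) := by
    by_contra! hlt
    exact (aleph0_le_mk (EqSig.Sts S T)).not_gt
      (h ▸ power_lt_aleph0 (natCast_lt_aleph0 (n := 2)) hlt)
  rw [h, ← two_power_aleph0]
  exact power_le_power_left two_ne_zero hinf

/-- A family of at most continuum many conditions, each asking for a witness depending on finitely
many parameters, can be met inside a set of cardinality at most the continuum: the substructure
generated by the empty set, for a language with Skolem functions for the conditions. -/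
theorem exists_mk_le_continuum_forall_exists_mem.{u} {Q : Type} {U : Type u} (hQ : #Q ≤ 𝔠)
    (W : Q → List U → U → Prop) :
    ∃ A : Set U, #A ≤ 𝔠 ∧
      ∀ q l, (∀ a ∈ l, a ∈ A) → (∃ u, W q l u) → ∃ u ∈ A, W q l u := by
  classical
  rcases isEmpty_or_nonempty U with hU | hU
  -- The constants of the language below need a nonempty structure.
  · exact ⟨∅, by simp, fun _ _ _ ⟨u, _⟩ => isEmptyElim u⟩
  let L : FirstOrder.Language.{0, 0} := ⟨fun _ => Q, fun _ => Empty⟩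
  let _ : L.Structure U :=
    { funMap := fun {_} q v => Classical.epsilon (W q (List.ofFn v))
      RelMap := fun r _ => r.elim }
  let A := FirstOrder.Language.Substructure.closure L (∅ : Set U)
  refine ⟨A, ?_, fun q l hl hu => ?_⟩
  · have hle := FirstOrder.Language.Substructure.lift_card_closure_le (L := L) (s := (∅ : Set U))
    have hF : #(Σ i, L.Functions i) ≤ 𝔠 := by
      change #(Σ _ : ℕ, Q) ≤ 𝔠
      rw [mk_sigma, sum_const', mk_nat]
      exact (mul_le_mul' aleph0_le_continuum hQ).trans_eq continuum_mul_self
    rw [lift_id'.{0, u}] at hle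
    refine hle.trans (max_le aleph0_le_continuum ?_)
    rw [mk_eq_zero, lift_zero, zero_add]
    exact (lift_le.2 hF).trans_eq lift_continuum
  · refine ⟨_, A.fun_mem (n := l.length) q l.get fun i => hl _ (l.get_mem i), ?_⟩
    have h := Classical.epsilon_spec hu
    change W q l (Classical.epsilon (W q (List.ofFn l.get)))
    rwa [List.ofFn_get]

end Cardinality

/-! ### Small witness-closed subsets -/

namespace RelModel

open Cardinal

theorem exists_isWitnessClosed_mk_le_continuum {S : RelSig} {X : Type} [Countable X]
    {U : Type*} (M : RelModel S U) :
    ∃ A : Set U, #A ≤ 𝔠 ∧ M.IsWitnessClosed X ((↑) : A → U) := by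
  let P := RelTerm S × RelTerm S
  let F := RelForm S X × X × List X
  have hQ : #((P ⊕ P ⊕ P) ⊕ F) ≤ 𝔠 := by
    rw [mk_sum, lift_id, lift_id]
    refine add_le_of_le aleph0_le_continuum (mk_le_aleph0.trans aleph0_le_continuum) ?_
    rw [mk_prod, lift_id, lift_id]
    exact (mul_le_mul' (RelForm.mk_le_continuum S X)
      (mk_le_aleph0.trans aleph0_le_continuum)).trans_eq continuum_mul_self
  -- The conditions are those of `IsWitnessClosed`, the separating pairs being chosen one component
  -- after the other; for an existential formula the list of bindings is split into the variables,
  -- which index the condition, and their values, which are its parameters.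
  obtain ⟨A, hA, hW⟩ := exists_mk_le_continuum_forall_exists_mem hQ <|
    Sum.elim
      (Sum.elim
        (fun (R, T) l u => ∃ a b, l = [a, b] ∧ (a, u) ∈ M.eval R ∧ (u, b) ∈ M.eval T)
        (Sum.elim
          (fun (R, T) _ u => ∃ b, ¬((u, b) ∈ M.eval R ↔ (u, b) ∈ M.eval T))
          (fun (R, T) l u => ∃ a, l = [a] ∧ ¬((a, u) ∈ M.eval R ↔ (a, u) ∈ M.eval T))))
      (fun (α, x, xs) l u =>
        M.Sat (listValuation ((x, u) :: xs.zip l)) α)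
  refine ⟨A, hA, ?_, ?_, ?_⟩
  · rintro R T a b ⟨u, hu⟩
    obtain ⟨c, hc, a', b', hab, h⟩ := hW (.inl (.inl (R, T))) [a.1, b.1] (by simp)
      ⟨u, a, b, rfl, hu⟩
    obtain ⟨rfl, rfl⟩ : a.1 = a' ∧ b.1 = b' := by simpa using hab
    exact ⟨⟨c, hc⟩, h⟩
  · intro R T hne
    obtain ⟨u, v, huv⟩ : ∃ u v, ¬((u, v) ∈ M.eval R ↔ (u, v) ∈ M.eval T) := by
      by_contra! h
      exact hne (Set.ext fun ⟨u, v⟩ => h u v)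
    obtain ⟨a, ha, v, hav⟩ := hW (.inl (.inr (.inl (R, T)))) [] (by simp) ⟨u, v, huv⟩
    obtain ⟨b, hb, a', haa, h⟩ := hW (.inl (.inr (.inr (R, T)))) [a] (by simpa using ha)
      ⟨v, a, rfl, hav⟩
    obtain rfl : a = a' := by simpa using haa
    exact ⟨⟨a, ha⟩, ⟨b, hb⟩, h⟩
  · intro α x l hu
    have hzip : l.map (Prod.map id ((↑) : A → U)) =
        (l.map Prod.fst).zip (l.map fun p => p.2.1) := by
      rw [List.zip_map']
      rfl
    rw [hzip] at hu ⊢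
    have hl : ∀ a ∈ l.map (fun p => p.2.1), a ∈ A := by simp +contextual
    obtain ⟨a, ha, h⟩ := hW (.inr (α, x, l.map Prod.fst)) _ hl hu
    exact ⟨⟨a, ha⟩, h⟩

end RelModel

/-- The pulled back model is carried over to the range of an embedding of its base set into the set
of states. -/
theorem RelModel.IsWitnessClosed.exists_statePCRA {St X : Type} {T : RelTheory X} {U V : Type*}
    {M : RelModel T.sig U} (hM : M.IsModelOf) {f : V → U} (h : M.IsWitnessClosed X f)
    (hf : Function.Injective f) (g : V ↪ St) :
    ∃ M' : StatePCRA St T, ∀ α : RelSen T.sig X, M.Models α → M'.model.Models α := by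
  let e : Set.range g ≃ V := (Equiv.ofInjective g g.injective).symm
  have h' := h.comp_equiv e
  have hmod := h'.models_pullback_iff (hf.comp e.injective)
  exact ⟨⟨Set.range g, h'.pullback (hf.comp e.injective), fun γ hγ => (hmod γ).2 (hM γ hγ)⟩,
    fun α hα => (hmod α).2 hα⟩

theorem mainTheorem4 {X : Type} [Countable X]
    (L : Logic) (K : StateSublanguage L) (RelTh : L.Sign → RelTheory X) (s : L.Sign)
    {U : Type*} (M : RelModel (RelTh s).sig U) (hM : M.IsModelOf)
    (hstates : Finite (K.States s) → Nonempty (U ↪ K.States s)) :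
    ∃ M' : StatePCRA (K.States s) (RelTh s),
      ∀ α : RelSen (RelTh s).sig X, M.Models α → M'.model.Models α := by
  rcases finite_or_infinite (K.States s) with hfin | hinf
  · obtain ⟨g⟩ := hstates hfin
    exact (M.isWitnessClosed_id X).exists_statePCRA hM Function.injective_id g
  · obtain ⟨A, hA, hclosed⟩ := M.exists_isWitnessClosed_mk_le_continuum (X := X)
    have : Infinite (EqSig.Sts (K.FSign.obj s) (K.RSign.obj s)) := hinf
    have hSt : Cardinal.continuum ≤ Cardinal.mk (K.States s) := EqSig.continuum_le_mk_sts _ _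
    obtain ⟨g⟩ : Nonempty (A ↪ K.States s) := by
      rw [← Cardinal.lift_mk_le']
      refine (Cardinal.lift_le_continuum.2 hA).trans ?_
      rwa [Cardinal.continuum_le_lift]
    exact hclosed.exists_statePCRA hM Subtype.val_injective g
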